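/- Definitions. A string attractor of a finite word $w=w[0]\cdots w[n-1]$ is a set $S\subseteq\{0,\dots,n-1\}$ such that every nonempty factor of $w$ has an occurrence in $w$ that touches a position in $S$. The span of $S$ is $\max S-\min S$ (and $0$ if $S=\emptyset$, which occurs only for the empty word). Let $\mathrm{maxspan}(w)$ and $\mathrm{minspan}(w)$ be the maximum and the minimum of the spans of the string attractors of $w$ of minimum cardinality. A numeration system represents each natural number by a word over a finite alphabet $D$, distinct numbers having distinct representations. A tuple of numbers is represented by reading the representations of its entries in parallel, aligned at their right ends, the shorter ones being padded on the left with a symbol not in $D$; a relation on $\mathbb N$ is recognized by a finite automaton that accepts exactly the representations of its elements. The numeration system is regular if the set of representations of the natural numbers is a regular language and the relation $x+y=z$ is recognized by a finite automaton. A sequence $\mathbf s=(s_n)_{n\ge 0}$ is automatic in the system if some finite automaton with output computes $s_n$ on input the representation of $n$. A function $f:\mathbb N\to\mathbb N$ is synchronized in the system if the relation $\{(n,f(n)) : n\ge 0\}$ is recognized by a finite automaton. Theorem. Let $\mathbf s$ be a sequence that is automatic in a regular numeration system, and suppose that there is a constant $c$ such that, for every $n$, the prefix $\mathbf s[0..n-1]$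 has a string attractor of cardinality at most $c$. Then the functions $f(n)=\mathrm{maxspan}(\mathbf s[0..n-1])$ and $g(n)=\mathrm{minspan}(\mathbf s[0..n-1])$ are synchronized in the same numeration system; that is, there are finite automata that recognize the representations of the pairs $(n,f(n))$ and of the pairs $(n,g(n))$, respectively. -/

import Mathlib

namespace StringAttractor

/-! ### Words, string attractors and span -/

section Words

variable {A : Type*}

/-- The prefix `s[0..n-1]` of length `n` of the infinite word `s`. -/
def pref (s : ℕ → A) (n : ℕ) : List A :=
  (List.range n).map s

/-- `f` occurs in `w` at position `p`, that is `w[p..p+|f|-1] = f`. -/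
def OccursAt (f w : List A) (p : ℕ) : Prop :=
  f <+: w.drop p

/-- `S` is a string attractor of `w`: a set of positions of `w` such that every nonempty factor
of `w` has an occurrence in `w` that touches a position in `S`. -/
def IsAttractor (w : List A) (S : Finset ℕ) : Prop :=
  (∀ i ∈ S, i < w.length) ∧
    ∀ f : List A, f ≠ [] → f <:+: w →
      ∃ p, OccursAt f w p ∧ ∃ i ∈ S, p ≤ i ∧ i < p + f.length

/-- `S` is a string attractor of `w` of minimum cardinality. -/
def IsMinAttractor (w : List A) (S : Finset ℕ) : Prop :=
  IsAttractor w S ∧ ∀ T : Finset ℕ, IsAttractor w T → S.card ≤ T.card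

/-- The span `max S - min S` of a set of positions; the span of the empty set, which is an
attractor of the empty word only, is `0` by convention. -/
def span (S : Finset ℕ) : ℕ :=
  if h : S.Nonempty then S.max' h - S.min' h else 0

/-- The set of spans of the minimum-cardinality string attractors of `w`. -/
def minAttractorSpans (w : List A) : Set ℕ :=
  {r | ∃ S : Finset ℕ, IsMinAttractor w S ∧ span S = r}

/-- The maximum span of a minimum-cardinality string attractor of `w`. -/
noncomputable def maxSpan (w : List A) : ℕ :=
  sSup (minAttractorSpans w)

/-- The minimum span of a minimum-cardinality string attractor of `w`. -/
noncomputable def minSpan (w : List A) : ℕ :=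
  sInf (minAttractorSpans w)

theorem isAttractor_range (w : List A) : IsAttractor w (Finset.range w.length) := by
  refine ⟨fun i hi => Finset.mem_range.1 hi, ?_⟩
  rintro f hf ⟨a, b, rfl⟩
  have h0 : 0 < f.length := List.length_pos_iff.2 hf
  refine ⟨a.length, ?_, a.length, ?_, le_rfl, by omega⟩
  · simp [OccursAt]
  · simp only [Finset.mem_range, List.length_append]
    omega

theorem minAttractorSpans_nonempty (w : List A) : (minAttractorSpans w).Nonempty := by
  classical
  have hex : ∃ k, ∃ S : Finset ℕ, IsAttractor w S ∧ S.card = k :=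
    ⟨_, _, isAttractor_range w, rfl⟩
  obtain ⟨S, hS, hk⟩ := Nat.find_spec hex
  refine ⟨span S, S, ⟨hS, fun T hT => ?_⟩, rfl⟩
  rw [hk]
  exact Nat.find_min' hex ⟨T, hT, rfl⟩

theorem minAttractorSpans_bddAbove (w : List A) : BddAbove (minAttractorSpans w) := by
  refine ⟨w.length, ?_⟩
  rintro r ⟨S, hS, rfl⟩
  unfold span
  split_ifs with h
  · have := hS.1.1 _ (S.max'_mem h)
    omega
  · exact Nat.zero_le _

/-- The supremum in `maxSpan` is a maximum. -/
theorem isGreatest_maxSpan (w : List A) : IsGreatest (minAttractorSpans w) (maxSpan w) :=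
  ⟨Nat.sSup_mem (minAttractorSpans_nonempty w) (minAttractorSpans_bddAbove w),
    fun _ h => le_csSup (minAttractorSpans_bddAbove w) h⟩

/-- The infimum in `minSpan` is a minimum. -/
theorem isLeast_minSpan (w : List A) : IsLeast (minAttractorSpans w) (minSpan w) :=
  ⟨Nat.sInf_mem (minAttractorSpans_nonempty w), fun _ h => Nat.sInf_le h⟩

end Words

/-! ### Numeration systems, automatic sequences and synchronized functions -/

/-- The word over `(D ∪ {none})^k` that encodes a `k`-tuple of words over `D` read in parallel:
the words are aligned at their right ends (last letters) and the shorter ones are padded on the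
left with the extra symbol `none` to the length of the longest one. -/
def convolution {D : Type*} {k : ℕ} (w : Fin k → List D) : List (Fin k → Option D) :=
  let L := Finset.univ.sup fun i => (w i).length
  (List.range L).map fun j i => (((w i).map some).leftpad L none).getD j none

/-- A numeration system with digits in `D`: every natural number is represented by a word over
`D`, its canonical representation, and distinct numbers have distinct representations. -/
structure NumerationSystem (D : Type*) where
  /-- the canonical representation of a natural number -/
  rep : ℕ → List D
  rep_injective : Function.Injective rep

namespace NumerationSystem

variable {D : Type*} (N : NumerationSystem D)

/-- A relation on natural numbers is recognizable if some finite automaton accepts exactly the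
representations, read in parallel, of the tuples in the relation. -/
def Recognizable {k : ℕ} (R : Set (Fin k → ℕ)) : Prop :=
  Language.IsRegular
    ({u | ∃ v ∈ R, convolution (fun i => N.rep (v i)) = u} : Language (Fin k → Option D))

/-- A numeration system is regular if the set of canonical representations is a regular language
and the relation `x + y = z` is recognizable by a finite automaton. -/
def Regular : Prop :=
  Language.IsRegular (Set.range N.rep : Language D) ∧
    N.Recognizable {v : Fin 3 → ℕ | v 0 + v 1 = v 2}

/-- The sequence `s` is automatic in the numeration system `N`: some finite automaton with output
computes `s n` on input the representation of `n`. -/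
def Automatic {A : Type*} (s : ℕ → A) : Prop :=
  ∃ (σ : Type) (_ : Fintype σ) (M : DFA D σ) (out : σ → A), ∀ n, out (M.eval (N.rep n)) = s n

/-- The function `f` is synchronized in the numeration system `N`: some finite automaton
recognizes the representations of the pairs `(n, f n)`. -/
def Synchronized (f : ℕ → ℕ) : Prop :=
  N.Recognizable {v : Fin 2 → ℕ | v 1 = f (v 0)}

end NumerationSystem

end StringAttractor

/-! In a regular numeration system, every relation that is first-order definable from addition and
from equality of terms of `s` is recognized by an automaton: connectives become Boolean operations
on regular languages, and an existential quantifier erases tracks. It remains to define the two span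
functions in this logic.

A factor of a prefix is given by its end points, so for fixed `k` it is a first-order property of
`n` and a `k`-tuple that the entries form an attractor (`isAttractor_pref_iff`). Finite sets of
unbounded size cannot be quantified over; the bound `c` leaves finitely many `k`, and minimality of
`k` says that no shorter tuple works (`mem_minAttractorSpans_iff`). The span is the difference of
two entries, and the greatest and least elements of a definable set of numbers are definable.

On the automata side the difficulty is padding, since a quantified number may have a longer
representation than the free ones. `RegularPred` therefore asks for correct answers under every
amount of padding. `RegularPred.exists_tuple` handles quantifiers, and `Recognizable.regularPred`
and `RegularPred.recognizable` pass to and from convolutions. -/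

namespace Language.IsRegular

/-! ### Closure properties of regular languages -/

variable {α β : Type*}

/-- Regularity from a DFA whose accepted words are described by a predicate. -/
theorem of_dfa {σ : Type*} [Finite σ] (M : DFA α σ) {L : Language α}
    (h : ∀ u, u ∈ L ↔ M.eval u ∈ M.accept) : L.IsRegular := by
  have := Fintype.ofFinite σ
  exact Language.isRegular_iff.2 ⟨σ, this, M, by ext u; rw [h]; rfl⟩

theorem of_nfa {σ : Type*} [Finite σ] (M : NFA α σ) {L : Language α}
    (h : ∀ u, u ∈ L ↔ u ∈ M.accepts) : L.IsRegular :=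
  of_dfa M.toDFA fun u => by rw [h, ← NFA.toDFA_correct]; rfl

/-- The preimage of a regular language under a letter-to-letter morphism is regular. -/
theorem preimage_map {L : Language β} (hL : L.IsRegular) (f : α → β) :
    Language.IsRegular ({u | u.map f ∈ L} : Language α) := by
  obtain ⟨σ, _, M, rfl⟩ := hL
  refine of_dfa (M.comap f) fun u => ?_
  rw [DFA.eval_comap]
  rfl

/-- The image of a regular language under a letter-to-letter morphism is regular. -/
theorem image_map {L : Language α} (hL : L.IsRegular) (f : α → β) :
    Language.IsRegular ({u | ∃ z ∈ L, z.map f = u} : Language β) := by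
  obtain ⟨σ, _, M, rfl⟩ := hL
  -- On each letter the automaton guesses a preimage under `f`.
  let M' : NFA β σ := ⟨fun s a => {t | ∃ b, f b = a ∧ t = M.step s b}, {M.start}, M.accept⟩
  have key : ∀ (u : List β) (t : σ), t ∈ M'.eval u ↔ ∃ z : List α, z.map f = u ∧ M.eval z = t := by
    intro u
    induction u using List.reverseRecOn with
    | nil =>
      intro t
      simp [M', eq_comm]
    | append_singleton u a ih =>
      intro t
      rw [NFA.eval_append_singleton, NFA.mem_stepSet]
      constructor
      · rintro ⟨s, hs, b, rfl, rfl⟩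
        obtain ⟨z, rfl, rfl⟩ := (ih s).1 hs
        exact ⟨z ++ [b], by simp, by simp⟩
      · rintro ⟨z, hz, rfl⟩
        obtain ⟨z₁, z₂, rfl, h₁, h₂⟩ := List.map_eq_append_iff.1 hz
        obtain ⟨b, rfl, hb⟩ := List.map_eq_singleton_iff.1 h₂
        exact ⟨M.eval z₁, (ih _).2 ⟨z₁, h₁, rfl⟩, b, hb, by simp⟩
  refine of_nfa M' fun u => ?_
  constructor
  · rintro ⟨z, hz, rfl⟩
    exact ⟨M.eval z, hz, (key _ _).2 ⟨z, rfl, rfl⟩⟩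
  · rintro ⟨t, ht, htu⟩
    obtain ⟨z, hz, rfl⟩ := (key _ _).1 htu
    exact ⟨z, ht, hz⟩

/-- The left quotient of a regular language by an arbitrary language is regular. -/
theorem leftQuotient_set {L : Language α} (hL : L.IsRegular) (K : Set (List α)) :
    Language.IsRegular ({u | ∃ x ∈ K, x ++ u ∈ L} : Language α) := by
  obtain ⟨σ, _, M, rfl⟩ := hL
  -- Only the set of states that `M` reaches on words of `K` matters, so `K` need not be regular.
  let M' : NFA α σ := ⟨fun s a => {M.step s a}, {s | ∃ x ∈ K, M.eval x = s}, M.accept⟩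
  have key : ∀ (u : List α) (t : σ), t ∈ M'.eval u ↔ ∃ x ∈ K, M.eval (x ++ u) = t := by
    intro u
    induction u using List.reverseRecOn with
    | nil =>
      intro t
      simp [M']
    | append_singleton u a ih =>
      intro t
      rw [NFA.eval_append_singleton, NFA.mem_stepSet]
      constructor
      · rintro ⟨s, hs, rfl⟩
        obtain ⟨x, hx, rfl⟩ := (ih s).1 hs
        exact ⟨x, hx, by rw [← List.append_assoc, DFA.eval_append_singleton]⟩
      · rintro ⟨x, hx, rfl⟩
        refine ⟨M.eval (x ++ u), (ih _).2 ⟨x, hx, rfl⟩, ?_⟩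
        rw [← List.append_assoc, DFA.eval_append_singleton]
        rfl
  refine of_nfa M' fun u => ?_
  constructor
  · rintro ⟨x, hx, hxu⟩
    exact ⟨M.eval (x ++ u), hxu, (key _ _).2 ⟨x, hx, rfl⟩⟩
  · rintro ⟨t, ht, htu⟩
    obtain ⟨x, hx, rfl⟩ := (key _ _).1 htu
    exact ⟨x, hx, ht⟩

theorem forall_finset {ι : Type*} {L : ι → Language α} (hL : ∀ i, (L i).IsRegular)
    (s : Finset ι) : Language.IsRegular ({u | ∀ i ∈ s, u ∈ L i} : Language α) := by
  classical
  induction s using Finset.induction_on with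
  | empty =>
    exact of_dfa (⟨fun s _ => s, (), Set.univ⟩ : DFA α Unit) fun u =>
      ⟨fun _ => trivial, fun _ i hi => by simp at hi⟩
  | insert i s _ ih =>
    have : ({u | ∀ j ∈ insert i s, u ∈ L j} : Language α) = L i ⊓ {u | ∀ j ∈ s, u ∈ L j} := by
      ext u
      exact Finset.forall_mem_insert i s fun j => u ∈ L j
    rw [this]
    exact (hL i).inf ih

/-- Finite intersections of regular languages are regular. -/
theorem forall_finite {ι : Type*} [Finite ι] {L : ι → Language α} (hL : ∀ i, (L i).IsRegular) :
    Language.IsRegular ({u | ∀ i, u ∈ L i} : Language α) := by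
  have := Fintype.ofFinite ι
  have h : ({u | ∀ i, u ∈ L i} : Language α) = {u | ∀ i ∈ Finset.univ, u ∈ L i} := by
    ext u
    exact ⟨fun h i _ => h i, fun h i => h i (Finset.mem_univ i)⟩
  rw [h]
  exact forall_finset hL Finset.univ

/-- Serves to single out the convolution among all paddings of a tuple: it is the only one that does
not start with a letter of pure padding. -/
theorem head_ne (a : α) : Language.IsRegular ({u | u.head? ≠ some a} : Language α) := by
  classical
  let M : DFA α (Option Bool) :=
    ⟨fun s b => s.elim (some (decide (b = a))) some, none, {some true}ᶜ⟩
  have key : ∀ u, M.eval u = u.head?.map fun b => decide (b = a) := by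
    intro u
    induction u using List.reverseRecOn with
    | nil => rfl
    | append_singleton u b ih =>
      rw [DFA.eval_append_singleton, ih]
      cases u <;> simp [M]
  refine of_dfa M fun u => ?_
  rw [key]
  change u.head? ≠ some a ↔ ¬ (u.head?.map (fun b => decide (b = a)) = some true)
  cases u <;> simp

/-- Padding the words of a regular language on the left with a letter `a` gives a regular
language. -/
theorem replicate_append {L : Language α} (hL : L.IsRegular) (a : α) :
    ∃ L' : Language α, L'.IsRegular ∧
      ∀ j w, w.head? ≠ some a → (List.replicate j a ++ w ∈ L' ↔ w ∈ L) := by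
  classical
  obtain ⟨σ, _, M, rfl⟩ := hL
  -- State `none` means that only `a` has been read so far; the first other letter starts `M`.
  -- Ending in `none` counts as ending in `M.start`, which covers empty `w`.
  let M' : DFA α (Option σ) :=
    ⟨fun s b => s.elim (if b = a then none else some (M.step M.start b))
      fun q => some (M.step q b), none, {s | s.getD M.start ∈ M.accept}⟩
  refine ⟨M'.accepts, of_dfa M' fun _ => Iff.rfl, fun j w hw => ?_⟩
  have h₁ : ∀ j, M'.eval (List.replicate j a) = none := by
    intro j
    induction j with
    | zero => rfl
    | succ j ih =>
      rw [List.replicate_succ', DFA.eval_append_singleton, ih]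
      simp [M']
  have h₂ : ∀ w q, M'.evalFrom (some q) w = some (M.evalFrom q w) := by
    intro w
    induction w with
    | nil => intro q; rfl
    | cons b w ih => intro q; exact ih _
  change M'.eval (List.replicate j a ++ w) ∈ M'.accept ↔ M.eval w ∈ M.accept
  rw [DFA.eval, DFA.evalFrom_of_append]
  change M'.evalFrom (M'.eval (List.replicate j a)) w ∈ _ ↔ _
  rw [h₁]
  cases w with
  | nil => rfl
  | cons b w =>
    have hb : b ≠ a := by simpa using hw
    have : M'.step none b = some (M.step M.start b) := by simp [M', hb]
    rw [DFA.evalFrom_cons, this, h₂]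
    rfl

end Language.IsRegular

namespace StringAttractor

/-! ### Padded tuples of words -/

section Padding

variable {D : Type*} {ι κ : Type*}

/-- The `κ`-tuple of words `w` read in parallel, padded on the left to the common length `m`. -/
def pad (m : ℕ) (w : ι → List D) : List (ι → Option D) :=
  (List.range m).map fun j i => (((w i).map some).leftpad m none).getD j none

theorem convolution_eq_pad {k : ℕ} (w : Fin k → List D) :
    convolution w = pad (Finset.univ.sup fun i => (w i).length) w :=
  rfl

@[simp]
theorem length_pad (m : ℕ) (w : ι → List D) : (pad m w).length = m := by
  simp [pad]

/-- The `i`-th track of a padded tuple is the padded `i`-th word. -/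
theorem map_eval_pad {m : ℕ} {w : ι → List D} {i : ι} (h : (w i).length ≤ m) :
    (pad m w).map (fun a => a i) = ((w i).map some).leftpad m none := by
  apply List.ext_getElem
  · simp [h]
  · intro j h₁ h₂
    simp only [pad, List.map_map, List.getElem_map, List.getElem_range, Function.comp_apply]
    exact List.getD_eq_getElem _ _ h₂

theorem map_comp_pad (m : ℕ) (w : ι → List D) (e : κ → ι) :
    (pad m w).map (fun a => a ∘ e) = pad m (w ∘ e) := by
  simp [pad, Function.comp_def]

/-- A word over tuples of letters is determined by its length and its tracks. -/
theorem ext_tracks {u v : List (ι → Option D)} (hl : u.length = v.length)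
    (h : ∀ i, u.map (fun a => a i) = v.map (fun a => a i)) : u = v := by
  refine List.ext_getElem hl fun j h₁ h₂ => funext fun i => ?_
  have := congrArg (fun l => l[j]?) (h i)
  simpa [List.getElem?_eq_getElem h₁, List.getElem?_eq_getElem h₂] using this

theorem eq_pad {m : ℕ} {w : ι → List D} {u : List (ι → Option D)} (hw : ∀ i, (w i).length ≤ m)
    (hl : u.length = m)
    (h : ∀ i, u.map (fun a => a i) = ((w i).map some).leftpad m none) : u = pad m w :=
  ext_tracks (by simp [hl]) fun i => by rw [h, map_eval_pad (hw i)]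

theorem leftpad_add {α : Type*} {m : ℕ} {l : List α} (h : l.length ≤ m) (j : ℕ) (a : α) :
    l.leftpad (j + m) a = List.replicate j a ++ l.leftpad m a := by
  rw [List.leftpad, List.leftpad, ← List.append_assoc, List.replicate_append_replicate]
  congr 2
  omega

theorem replicate_append_pad {m : ℕ} {w : ι → List D} (hw : ∀ i, (w i).length ≤ m) (j : ℕ) :
    List.replicate j (fun _ => none) ++ pad m w = pad (j + m) w := by
  refine eq_pad (fun i => (hw i).trans (Nat.le_add_left _ _)) (by simp) fun i => ?_
  rw [List.map_append, map_eval_pad (hw i), leftpad_add (by simpa using hw i)]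
  simp

theorem reduceOption_leftpad (m : ℕ) (l : List D) :
    ((l.map some).leftpad m none).reduceOption = l := by
  rw [List.leftpad, List.reduceOption_append, List.reduceOption_replicate_none, List.nil_append]
  induction l with
  | nil => rfl
  | cons a l ih => simp [List.reduceOption_cons_of_some, ih]

theorem length_le_sup [Fintype ι] (w : ι → List D) (i : ι) :
    (w i).length ≤ Finset.univ.sup fun i => (w i).length :=
  Finset.le_sup (f := fun i => (w i).length) (Finset.mem_univ i)

theorem pad_injective {m : ℕ} {w w' : ι → List D} (hw : ∀ i, (w i).length ≤ m)
    (hw' : ∀ i, (w' i).length ≤ m) (h : pad m w = pad m w') : w = w' := by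
  funext i
  rw [← reduceOption_leftpad m (w i), ← reduceOption_leftpad m (w' i), ← map_eval_pad (hw i),
    ← map_eval_pad (hw' i), h]

/-- A padded tuple of the least possible length does not begin with a padding letter. -/
theorem head?_pad_sup [Fintype ι] (w : ι → List D) :
    (pad (Finset.univ.sup fun i => (w i).length) w).head? ≠ some fun _ => none := by
  intro h
  set L := Finset.univ.sup fun i => (w i).length with hL
  have hpos : 0 < L := by
    rcases Nat.eq_zero_or_pos L with h0 | h0
    · rw [h0] at h
      simp [pad] at h
    · exact h0
  have hne : (Finset.univ : Finset ι).Nonempty := by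
    by_contra hne
    rw [Finset.not_nonempty_iff_eq_empty] at hne
    simp [hL, hne] at hpos
  -- A longest component receives no padding, so its track starts with a digit.
  obtain ⟨i, -, hi⟩ := Finset.exists_mem_eq_sup _ hne fun i => (w i).length
  have h₁ : ((pad L w).map fun a => a i).head? = some none := by
    rw [List.head?_map, h]
    rfl
  rw [map_eval_pad (length_le_sup w i), List.leftpad] at h₁
  rw [← hL] at hi
  cases hwi : w i with
  | nil => simp [hi, hwi] at hpos
  | cons a l =>
    rw [← hL, hi, hwi] at h₁
    simp at h₁

end Padding

/-! ### Predicates decided by automata, independently of padding -/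

namespace NumerationSystem

variable {D : Type*} (N : NumerationSystem D) {ι κ : Type*}

/-- The tuple `v` of natural numbers is represented within length `m`. -/
def Fits (m : ℕ) (v : ι → ℕ) : Prop :=
  ∀ i, (N.rep (v i)).length ≤ m

/-- The representation of the tuple `v` padded on the left to length `m`. -/
def padRep (m : ℕ) (v : ι → ℕ) : List (ι → Option D) :=
  pad m fun i => N.rep (v i)

/-- A predicate on tuples of natural numbers is decided by a regular language when that language
tests the representations of the tuples with arbitrary amounts of padding. -/
def RegularPred (P : (ι → ℕ) → Prop) : Prop :=
  ∃ L : Language (ι → Option D), L.IsRegular ∧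
    ∀ v m, N.Fits m v → (N.padRep m v ∈ L ↔ P v)

variable {N}

theorem map_eval_padRep {m : ℕ} {v : ι → ℕ} (h : N.Fits m v) (i : ι) :
    (N.padRep m v).map (fun a => a i) = ((N.rep (v i)).map some).leftpad m none :=
  map_eval_pad (w := fun i => N.rep (v i)) (h i)

theorem exists_fits [Finite ι] (v : ι → ℕ) : ∃ m, N.Fits m v := by
  have := Fintype.ofFinite ι
  exact ⟨_, length_le_sup fun i => N.rep (v i)⟩

theorem Fits.mono {m m' : ℕ} {v : ι → ℕ} (h : N.Fits m v) (hm : m ≤ m') : N.Fits m' v :=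
  fun i => (h i).trans hm

theorem RegularPred.congr {P Q : (ι → ℕ) → Prop} (hP : N.RegularPred P) (h : ∀ v, P v ↔ Q v) :
    N.RegularPred Q := by
  rwa [← (funext fun v => propext (h v) : P = Q)]

theorem RegularPred.not {P : (ι → ℕ) → Prop} (hP : N.RegularPred P) :
    N.RegularPred fun v => ¬ P v := by
  obtain ⟨L, hL, h⟩ := hP
  exact ⟨Lᶜ, hL.compl, fun v m hm => not_congr (h v m hm)⟩

theorem RegularPred.and {P Q : (ι → ℕ) → Prop} (hP : N.RegularPred P) (hQ : N.RegularPred Q) :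
    N.RegularPred fun v => P v ∧ Q v := by
  obtain ⟨L, hL, h⟩ := hP
  obtain ⟨L', hL', h'⟩ := hQ
  exact ⟨L ⊓ L', hL.inf hL', fun v m hm => and_congr (h v m hm) (h' v m hm)⟩

theorem RegularPred.or {P Q : (ι → ℕ) → Prop} (hP : N.RegularPred P) (hQ : N.RegularPred Q) :
    N.RegularPred fun v => P v ∨ Q v :=
  (hP.not.and hQ.not).not.congr fun _ => by tauto

theorem RegularPred.imp {P Q : (ι → ℕ) → Prop} (hP : N.RegularPred P) (hQ : N.RegularPred Q) :
    N.RegularPred fun v => P v → Q v :=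
  (hP.and hQ.not).not.congr fun _ => by tauto

theorem RegularPred.const (p : Prop) : N.RegularPred fun _ : ι → ℕ => p :=
  ⟨{_u | p}, .of_dfa (⟨fun s _ => s, (), {_s | p}⟩ : DFA _ Unit) fun _ => Iff.rfl,
    fun _ _ _ => Iff.rfl⟩

theorem RegularPred.forall_mem {α : Type*} (s : Finset α) {P : α → (ι → ℕ) → Prop}
    (hP : ∀ a, N.RegularPred (P a)) : N.RegularPred fun v => ∀ a ∈ s, P a v := by
  classical
  induction s using Finset.induction_on with
  | empty => exact (RegularPred.const True).congr fun v => by simp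
  | insert a s _ ih => exact ((hP a).and ih).congr fun v => by simp

theorem RegularPred.forall_fin {k : ℕ} {P : Fin k → (ι → ℕ) → Prop}
    (hP : ∀ a, N.RegularPred (P a)) : N.RegularPred fun v => ∀ a, P a v :=
  (RegularPred.forall_mem Finset.univ hP).congr fun v => by simp

theorem RegularPred.exists_fin {k : ℕ} {P : Fin k → (ι → ℕ) → Prop}
    (hP : ∀ a, N.RegularPred (P a)) : N.RegularPred fun v => ∃ a, P a v :=
  (RegularPred.forall_fin fun a => (hP a).not).not.congr fun v => by simp

/-- Substitution of variables. -/
theorem RegularPred.comp {P : (κ → ℕ) → Prop} (hP : N.RegularPred P) (e : κ → ι) :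
    N.RegularPred fun v => P (v ∘ e) := by
  obtain ⟨L, hL, h⟩ := hP
  refine ⟨_, hL.preimage_map fun a => a ∘ e, fun v m hm => ?_⟩
  refine Iff.trans ?_ (h (v ∘ e) m fun i => hm (e i))
  change (N.padRep m v).map (fun a => a ∘ e) ∈ L ↔ _
  rw [padRep, map_comp_pad]
  rfl

/-- The padded representations of tuples form a regular language. -/
theorem isRegular_padRep [Finite ι] (hN : Language.IsRegular (Set.range N.rep : Language D)) :
    Language.IsRegular
      ({u | ∃ v, N.Fits u.length v ∧ u = N.padRep u.length v} : Language (ι → Option D)) := by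
  obtain ⟨L, hL, h⟩ := (hN.image_map some).replicate_append none
  have key : ∀ u : List (Option D),
      u ∈ L ↔ ∃ n, (N.rep n).length ≤ u.length ∧ u = ((N.rep n).map some).leftpad u.length none := by
    intro u
    constructor
    · intro hu
      -- Splits off the maximal leading block of padding, which puts `u` in the form that `h`
      -- treats.
      obtain ⟨j, w, rfl, hw⟩ : ∃ j w, u = List.replicate j none ++ w ∧ w.head? ≠ some none := by
        clear hu
        induction u with
        | nil => exact ⟨0, [], rfl, by simp⟩
        | cons a u ih =>
          cases a with
          | none =>
            obtain ⟨j, w, rfl, hw⟩ := ih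
            exact ⟨j + 1, w, rfl, hw⟩
          | some d => exact ⟨0, _, rfl, by simp⟩
      obtain ⟨_, ⟨n, rfl⟩, rfl⟩ := (h j w hw).1 hu
      exact ⟨n, by simp, by simp [List.leftpad]⟩
    · rintro ⟨n, -, hu⟩
      rw [hu, List.leftpad, h]
      · exact ⟨_, ⟨n, rfl⟩, rfl⟩
      · cases N.rep n <;> simp
  have h₂ := Language.IsRegular.forall_finite fun i : ι =>
    hL.preimage_map fun a : ι → Option D => a i
  refine (congrArg Language.IsRegular (Set.ext fun u => ?_)).mpr h₂
  change (∃ v, N.Fits u.length v ∧ u = N.padRep u.length v) ↔ ∀ i, u.map (fun a => a i) ∈ L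
  simp only [key, List.length_map]
  constructor
  · rintro ⟨v, hv, hu⟩ i
    refine ⟨v i, hv i, ?_⟩
    conv_lhs => rw [hu]
    exact map_eval_pad (hv i)
  · intro hu
    choose v hv hu using hu
    exact ⟨v, hv, eq_pad hv rfl hu⟩

/-- Existential quantification over a tuple of variables. -/
theorem RegularPred.exists_tuple [Finite κ]
    (hN : Language.IsRegular (Set.range N.rep : Language D)) {P : (ι → ℕ) → (κ → ℕ) → Prop}
    (hP : N.RegularPred fun w : ι ⊕ κ → ℕ => P (w ∘ Sum.inl) (w ∘ Sum.inr)) :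
    N.RegularPred fun v => ∃ t, P v t := by
  obtain ⟨L, hL, h⟩ := hP
  -- The intersection forces the erased tracks to represent actual numbers. The quotient by blocks
  -- of padding is needed because `t` may not fit in the length `m` available for `v`.
  have h₁ := hL.inf ((isRegular_padRep (ι := κ) hN).preimage_map fun a : ι ⊕ κ → Option D =>
    a ∘ Sum.inr)
  have h₂ := (h₁.image_map fun a : ι ⊕ κ → Option D => a ∘ Sum.inl).leftQuotient_set
    (Set.range fun j => List.replicate j fun _ => none)
  refine ⟨_, h₂, fun v m hm => ?_⟩
  constructor
  · rintro ⟨_, ⟨j, rfl⟩, z, ⟨hz, t, ht, hzt⟩, hzv⟩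
    have hlen : z.length = j + m := by
      have := congrArg List.length hzv
      simpa [padRep] using this
    have hzv' : z.map (fun a => a ∘ Sum.inl) = N.padRep (j + m) v := by
      rw [hzv]
      exact replicate_append_pad hm j
    rw [List.length_map, hlen] at hzt ht
    have hfit : N.Fits (j + m) (Sum.elim v t) := by
      rintro (i | i)
      · exact hm.mono (Nat.le_add_left _ _) i
      · exact ht i
    have hz' : z = N.padRep (j + m) (Sum.elim v t) := by
      refine eq_pad hfit hlen ?_
      rintro (i | i)
      · have := congrArg (List.map fun a => a i) hzv'
        rw [map_eval_padRep (hm.mono (Nat.le_add_left _ _)), List.map_map] at this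
        exact this
      · have := congrArg (List.map fun a => a i) hzt
        rw [map_eval_padRep ht, List.map_map] at this
        exact this
    rw [hz'] at hz
    exact ⟨t, (h _ _ hfit).1 hz⟩
  · rintro ⟨t, ht⟩
    obtain ⟨j, hj⟩ := N.exists_fits t
    have hfit : N.Fits (j + m) (Sum.elim v t) := by
      rintro (i | i)
      · exact hm.mono (Nat.le_add_left _ _) i
      · exact hj.mono (Nat.le_add_right _ _) i
    refine ⟨_, ⟨j, rfl⟩, N.padRep (j + m) (Sum.elim v t), ⟨(h _ _ hfit).2 ht, t, ?_, ?_⟩, ?_⟩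
    · simpa [padRep] using hj.mono (Nat.le_add_right _ _)
    · rw [List.length_map, padRep, length_pad, map_comp_pad]
      rfl
    · exact (map_comp_pad _ _ _).trans (replicate_append_pad hm j).symm

/-- The convolution is the shortest padding and does not start with a letter of pure padding, so
`replicate_append` extends the test to all longer paddings. -/
theorem Recognizable.regularPred {k : ℕ} {R : Set (Fin k → ℕ)} (hR : N.Recognizable R) :
    N.RegularPred fun v => v ∈ R := by
  obtain ⟨L, hL, h⟩ := hR.replicate_append fun _ => none
  refine ⟨L, hL, fun v m hm => ?_⟩
  obtain ⟨j, rfl⟩ := Nat.exists_eq_add_of_le'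
    (Finset.sup_le fun i _ => hm i : Finset.univ.sup (fun i => (N.rep (v i)).length) ≤ m)
  rw [padRep, ← replicate_append_pad (length_le_sup fun i => N.rep (v i)),
    h _ _ (head?_pad_sup _)]
  constructor
  · rintro ⟨v', hv', hc⟩
    have hl : Finset.univ.sup (fun i => (N.rep (v' i)).length) =
        Finset.univ.sup fun i => (N.rep (v i)).length := by
      simpa [convolution_eq_pad] using congrArg List.length hc
    rw [convolution_eq_pad, hl] at hc
    have := pad_injective (hl ▸ length_le_sup fun i => N.rep (v' i))
      (length_le_sup fun i => N.rep (v i)) hc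
    rwa [← (funext fun i => N.rep_injective (congrFun this i) : v' = v)]
  · exact fun hv => ⟨v, hv, rfl⟩

theorem RegularPred.recognizable (hN : Language.IsRegular (Set.range N.rep : Language D)) {k : ℕ}
    {R : Set (Fin k → ℕ)} (hR : N.RegularPred fun v => v ∈ R) : N.Recognizable R := by
  obtain ⟨L, hL, h⟩ := hR
  have h' := (hL.inf (isRegular_padRep (ι := Fin k) hN)).inf (.head_ne fun _ => none)
  refine (congrArg Language.IsRegular (Set.ext fun u => ?_)).mpr h'
  constructor
  · rintro ⟨v, hv, rfl⟩
    have hfit : N.Fits _ v := length_le_sup fun i => N.rep (v i)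
    refine ⟨⟨(h v _ hfit).2 hv, v, ?_, ?_⟩, head?_pad_sup _⟩
    · simpa [convolution_eq_pad] using hfit
    · rw [convolution_eq_pad, length_pad]
      rfl
  · rintro ⟨⟨hu, v, hv, huv⟩, hhead⟩
    rw [huv] at hu hhead
    refine ⟨v, (h v _ hv).1 hu, ?_⟩
    rw [convolution_eq_pad, huv]
    obtain ⟨j, hj⟩ := Nat.exists_eq_add_of_le'
      (Finset.sup_le fun i _ => hv i :
        Finset.univ.sup (fun i => (N.rep (v i)).length) ≤ u.length)
    rw [hj] at hhead ⊢
    rw [padRep, ← replicate_append_pad (length_le_sup fun i => N.rep (v i))] at hhead ⊢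
    -- Any extra padding would put a letter of pure padding in front, against `hhead`.
    cases j with
    | zero => rfl
    | succ j => exact absurd rfl hhead

/-- Equality of two terms of an automatic sequence is decided by a regular language. -/
theorem Automatic.regularPred_eq {A : Type*} {s : ℕ → A} (hs : N.Automatic s) (i j : ι) :
    N.RegularPred fun v => s (v i) = s (v j) := by
  obtain ⟨σ, _, M, out, hout⟩ := hs
  -- Two copies of `M` read tracks `i` and `j`, standing still on padding.
  let M' : DFA (ι → Option D) (σ × σ) :=
    ⟨fun q a => ((a i).elim q.1 (M.step q.1), (a j).elim q.2 (M.step q.2)),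
      (M.start, M.start), {q | out q.1 = out q.2}⟩
  have key : ∀ u, M'.eval u = (M.eval (u.map fun a => a i).reduceOption,
      M.eval (u.map fun a => a j).reduceOption) := by
    intro u
    induction u using List.reverseRecOn with
    | nil => rfl
    | append_singleton u a ih =>
      rw [DFA.eval_append_singleton, ih]
      simp only [List.map_append, List.map_singleton, List.reduceOption_append]
      refine Prod.ext ?_ ?_
      · cases hi : a i <;>
          simp [M', hi, List.reduceOption_cons_of_some, List.reduceOption_cons_of_none]
      · cases hj : a j <;>
          simp [M', hj, List.reduceOption_cons_of_some, List.reduceOption_cons_of_none]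
  refine ⟨M'.accepts, .of_dfa M' fun _ => Iff.rfl, fun v m hm => ?_⟩
  change M'.eval _ ∈ M'.accept ↔ _
  rw [key, map_eval_padRep hm, map_eval_padRep hm, reduceOption_leftpad,
    reduceOption_leftpad]
  change out _ = out _ ↔ _
  rw [hout, hout]

end NumerationSystem

end StringAttractor

namespace StringAttractor

namespace NumerationSystem

/-! ### Quantifiers, addition and order -/

section FirstOrder

variable {D : Type*} {N : NumerationSystem D} {ι : Type*}

theorem RegularPred.exists_mem {α : Type*} (s : Finset α) {P : α → (ι → ℕ) → Prop}
    (hP : ∀ a, N.RegularPred (P a)) : N.RegularPred fun v => ∃ a ∈ s, P a v :=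
  (RegularPred.forall_mem s fun a => (hP a).not).not.congr fun v => by simp

/-- Existential quantification over one variable, which is the variable `none` of the matrix. -/
theorem RegularPred.exists_nat (hN : Language.IsRegular (Set.range N.rep : Language D))
    {P : (ι → ℕ) → ℕ → Prop}
    (hP : N.RegularPred fun w : Option ι → ℕ => P (fun i => w (some i)) (w none)) :
    N.RegularPred fun v => ∃ x, P v x := by
  have h := RegularPred.exists_tuple (κ := Unit) hN (P := fun v t => P v (t ()))
    (hP.comp fun o : Option ι => o.elim (Sum.inr ()) Sum.inl)
  exact h.congr fun v => ⟨fun ⟨t, ht⟩ => ⟨_, ht⟩, fun ⟨x, hx⟩ => ⟨fun _ => x, hx⟩⟩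

theorem RegularPred.forall_nat (hN : Language.IsRegular (Set.range N.rep : Language D))
    {P : (ι → ℕ) → ℕ → Prop}
    (hP : N.RegularPred fun w : Option ι → ℕ => P (fun i => w (some i)) (w none)) :
    N.RegularPred fun v => ∀ x, P v x :=
  (RegularPred.exists_nat hN (P := fun v x => ¬ P v x) hP.not).not.congr fun v => by simp

theorem Regular.add_eq (hN : N.Regular) (i j k : ι) :
    N.RegularPred fun v => v i + v j = v k :=
  hN.2.regularPred.comp ![i, j, k]

theorem Regular.add_eq_add (hN : N.Regular) (i j k l : ι) :
    N.RegularPred fun v => v i + v j = v k + v l :=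
  (RegularPred.exists_nat hN.1 (P := fun v x => v i + v j = x ∧ v k + v l = x)
    ((hN.add_eq (some i) (some j) none).and (hN.add_eq (some k) (some l) none))).congr
    fun v => by simp [eq_comm]

theorem Regular.le (hN : N.Regular) (i j : ι) : N.RegularPred fun v => v i ≤ v j :=
  (RegularPred.exists_nat hN.1 (P := fun v x => v i + x = v j)
    (hN.add_eq (some i) none (some j))).congr fun v => by
      simp [le_iff_exists_add, eq_comm]

theorem Regular.lt (hN : N.Regular) (i j : ι) : N.RegularPred fun v => v i < v j :=
  (hN.le j i).not.congr fun _ => not_le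

end FirstOrder

end NumerationSystem

/-! ### First-order description of attractors and spans -/

section Attractors

variable {A : Type*}

theorem occursAt_pref_iff {s : ℕ → A} {n p : ℕ} {f : List A} (hf : f ≠ []) :
    OccursAt f (pref s n) p ↔
      p + f.length ≤ n ∧ f = (List.range f.length).map fun i => s (p + i) := by
  have h0 : 0 < f.length := List.length_pos_iff.2 hf
  have hlen : ((pref s n).drop p).length = n - p := by simp [pref]
  have htake : p + f.length ≤ n →
      ((pref s n).drop p).take f.length = (List.range f.length).map fun i => s (p + i) := by
    intro hp
    apply List.ext_getElem
    · simp [pref]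
      omega
    · intro i h₁ h₂
      simp [pref]
  rw [OccursAt, List.prefix_iff_eq_take]
  constructor
  · intro h
    have hp : p + f.length ≤ n := by
      have := congrArg List.length h
      rw [List.length_take, hlen] at this
      omega
    exact ⟨hp, htake hp ▸ h⟩
  · rintro ⟨hp, h⟩
    rwa [htake hp]

theorem isInfix_iff_exists_occursAt {f w : List A} : f <:+: w ↔ ∃ p, OccursAt f w p := by
  constructor
  · rintro ⟨a, b, rfl⟩
    exact ⟨a.length, by simp [OccursAt]⟩
  · rintro ⟨p, h⟩
    exact h.isInfix.trans (List.drop_suffix p w).isInfix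

/-- The string attractors of a prefix of `s` in terms of the positions of the factors. -/
theorem isAttractor_pref_iff {s : ℕ → A} {n k : ℕ} {t : Fin k → ℕ} :
    IsAttractor (pref s n) (Finset.univ.image t) ↔
      (∀ j, t j < n) ∧ ∀ a b, a < b → b ≤ n → ∃ p e, p + b = e + a ∧ e ≤ n ∧
        (∀ x y, a ≤ x → x < b → x + p = y + a → s x = s y) ∧ ∃ j, p ≤ t j ∧ t j < e := by
  have hn : (pref s n).length = n := by simp [pref]
  rw [IsAttractor, hn]
  -- The factor is `s[a..b-1]` and its occurrence `s[p..e-1]`. The equations `p + b = e + a` and `x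
  -- + p = y + a` express equal lengths and equal offsets without subtraction.
  refine and_congr (by simp) ?_
  constructor
  · intro h a b hab hb
    have hl : ((List.range (b - a)).map fun i => s (a + i)).length = b - a := by simp
    have hne : ((List.range (b - a)).map fun i => s (a + i)) ≠ [] := by
      rw [← List.length_pos_iff, hl]
      omega
    obtain ⟨p, hp, i, hi, hpi, hip⟩ := h _ hne
      (isInfix_iff_exists_occursAt.2 ⟨a, (occursAt_pref_iff hne).2 ⟨by rw [hl]; omega, by rw [hl]⟩⟩)
    rw [occursAt_pref_iff hne, hl] at hp
    rw [hl] at hip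
    obtain ⟨j, -, rfl⟩ := Finset.mem_image.1 hi
    refine ⟨p, p + (b - a), by omega, hp.1, ?_, j, hpi, hip⟩
    intro x y hax hxb hxy
    have := List.map_inj_left.1 hp.2 (x - a) (List.mem_range.2 (by omega))
    rwa [show a + (x - a) = x by omega, show p + (x - a) = y by omega] at this
  · intro h f hf hfw
    obtain ⟨a, ha⟩ := isInfix_iff_exists_occursAt.1 hfw
    obtain ⟨han, haf⟩ := (occursAt_pref_iff hf).1 ha
    have h0 : 0 < f.length := List.length_pos_iff.2 hf
    obtain ⟨p, e, hpe, hen, heq, j, hpj, hje⟩ := h a (a + f.length) (by omega) han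
    refine ⟨p, (occursAt_pref_iff hf).2 ⟨by omega, haf.trans ?_⟩, t j, by simp, hpj, by omega⟩
    refine List.map_inj_left.2 fun i hi => heq _ _ (by omega) ?_ (by omega)
    have := List.mem_range.1 hi
    omega

/-- For `k = 0` the span is `0` by convention, and `r + r = r` says `r = 0` using addition alone. -/
theorem span_image_eq_iff {k r : ℕ} {t : Fin k → ℕ} :
    span (Finset.univ.image t) = r ↔
      (k = 0 ∧ r + r = r) ∨ ∃ i j, (∀ l, t i ≤ t l ∧ t l ≤ t j) ∧ t i + r = t j := by
  rcases Nat.eq_zero_or_pos k with rfl | hk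
  · simp [span, eq_comm]
  have hne : (Finset.univ.image t).Nonempty := ⟨t ⟨0, hk⟩, by simp⟩
  have hmem : ∀ l, t l ∈ Finset.univ.image t := fun l => by simp
  rw [span, dif_pos hne]
  constructor
  · intro h
    obtain ⟨i, -, hi⟩ := Finset.mem_image.1 (Finset.min'_mem _ hne)
    obtain ⟨j, -, hj⟩ := Finset.mem_image.1 (Finset.max'_mem _ hne)
    rw [← hi, ← hj] at h
    have hmin : ∀ l, t i ≤ t l := fun l => hi ▸ Finset.min'_le _ _ (hmem l)
    exact .inr ⟨i, j, fun l => ⟨hmin l, hj ▸ Finset.le_max' _ _ (hmem l)⟩, by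
      have := hmin j
      omega⟩
  · rintro (⟨rfl, -⟩ | ⟨i, j, hij, hr⟩)
    · exact absurd hk (lt_irrefl 0)
    have hmin : (Finset.univ.image t).min' hne = t i :=
      le_antisymm (Finset.min'_le _ _ (hmem i))
        (Finset.le_min' _ _ _ (by simpa using fun l => (hij l).1))
    have hmax : (Finset.univ.image t).max' hne = t j :=
      le_antisymm (Finset.max'_le _ _ _ (by simpa using fun l => (hij l).2))
        (Finset.le_max' _ _ (hmem j))
    rw [hmin, hmax]
    omega

theorem exists_image_eq (S : Finset ℕ) : ∃ t : Fin S.card → ℕ, Finset.univ.image t = S :=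
  ⟨S.orderEmbOfFin rfl, by
    apply Finset.coe_injective
    simp⟩

/-- The spans of the minimum attractors of a word that has an attractor of size at most `c`. -/
theorem mem_minAttractorSpans_iff {w : List A} {c r : ℕ}
    (hc : ∃ S, IsAttractor w S ∧ S.card ≤ c) :
    r ∈ minAttractorSpans w ↔ ∃ k ∈ Finset.range (c + 1),
      (∃ t : Fin k → ℕ, IsAttractor w (Finset.univ.image t) ∧ span (Finset.univ.image t) = r) ∧
        ∀ l ∈ Finset.range k, ¬ ∃ t : Fin l → ℕ, IsAttractor w (Finset.univ.image t) := by
  constructor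
  · rintro ⟨S, ⟨hS, hmin⟩, hr⟩
    obtain ⟨S', hS', hcard⟩ := hc
    refine ⟨S.card, Finset.mem_range.2 (Nat.lt_succ_of_le ((hmin S' hS').trans hcard)), ?_, ?_⟩
    · obtain ⟨t, ht⟩ := exists_image_eq S
      exact ⟨t, by rwa [ht], by rwa [ht]⟩
    · rintro l hl ⟨t, ht⟩
      have h₁ := hmin _ ht
      have h₂ : (Finset.univ.image t).card ≤ l := by
        simpa using Finset.card_image_le (s := Finset.univ) (f := t)
      exact absurd (Finset.mem_range.1 hl) (by omega)
  · rintro ⟨k, -, ⟨t, ht, hr⟩, hmin⟩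
    refine ⟨_, ⟨ht, fun T hT => ?_⟩, hr⟩
    by_contra hlt
    -- The tuple may repeat entries, so only an inequality is available; it suffices, since a
    -- smaller attractor `T` would yield a tuple of length below `k`.
    have h₂ : (Finset.univ.image t).card ≤ k := by
      simpa using Finset.card_image_le (s := Finset.univ) (f := t)
    obtain ⟨t', ht'⟩ := exists_image_eq T
    exact hmin T.card (Finset.mem_range.2 (by omega)) ⟨t', by rwa [ht']⟩

end Attractors

/-! ### Automata for attractors and their spans -/

namespace NumerationSystem

variable {D : Type*} {N : NumerationSystem D} {ι : Type*} {A : Type*} {s : ℕ → A}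

/-- Transcribes `isAttractor_pref_iff` with de Bruijn indices: `none` is the innermost bound
variable and each `some` crosses one quantifier. From the outside in, the variables are `a`, `b`,
`p`, `e`, `x`, `y`. -/
theorem Regular.isAttractor (hN : N.Regular) (hs : N.Automatic s) {k : ℕ} (n : ι) (t : Fin k → ι) :
    N.RegularPred fun v => IsAttractor (pref s (v n)) (Finset.univ.image (v ∘ t)) := by
  refine RegularPred.congr ?_ fun v => isAttractor_pref_iff.symm
  refine (RegularPred.forall_fin fun j => hN.lt (t j) n).and ?_
  refine .forall_nat hN.1 (.forall_nat hN.1 ?_)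
  refine (hN.lt (some none) none).imp ((hN.le none (some (some n))).imp ?_)
  refine .exists_nat hN.1 (.exists_nat hN.1 ?_)
  refine (hN.add_eq_add (some none) (some (some none)) none (some (some (some none)))).and
    ((hN.le none (some (some (some (some n))))).and (.and ?_ ?_))
  · refine .forall_nat hN.1 (.forall_nat hN.1 ?_)
    exact (hN.le (some (some (some (some (some none))))) (some none)).imp
      ((hN.lt (some none) (some (some (some (some none))))).imp
        ((hN.add_eq_add (some none) (some (some (some none))) none
          (some (some (some (some (some none)))))).imp (hs.regularPred_eq (some none) none)))
  · exact .exists_fin fun j => (hN.le (some none) (some (some (some (some (t j)))))).and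
      (hN.lt (some (some (some (some (t j))))) none)

theorem Regular.span_eq (hN : N.Regular) {k : ℕ} (t : Fin k → ι) (r : ι) :
    N.RegularPred fun v => span (Finset.univ.image (v ∘ t)) = v r := by
  refine RegularPred.congr ?_ fun v => span_image_eq_iff.symm
  refine ((RegularPred.const (k = 0)).and (hN.add_eq r r r)).or ?_
  exact .exists_fin fun i => .exists_fin fun j =>
    (RegularPred.forall_fin fun l => (hN.le (t i) (t l)).and (hN.le (t l) (t j))).and
      (hN.add_eq (t i) r (t j))

/-- If the attractors of the prefixes of an automatic sequence have bounded size, the relation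
between `n` and the spans of the minimum attractors of the prefix of length `n` is regular. -/
theorem Regular.mem_minAttractorSpans (hN : N.Regular) (hs : N.Automatic s) {c : ℕ}
    (hc : ∀ n, ∃ S, IsAttractor (pref s n) S ∧ S.card ≤ c) (n r : ι) :
    N.RegularPred fun v => v r ∈ minAttractorSpans (pref s (v n)) := by
  refine RegularPred.congr ?_ fun v => (mem_minAttractorSpans_iff (hc (v n))).symm
  refine .exists_mem _ fun k => .and ?_ (.forall_mem _ fun l => .not ?_)
  · exact .exists_tuple hN.1 ((hN.isAttractor hs (Sum.inl n) Sum.inr).and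
      (hN.span_eq Sum.inr (Sum.inl r)))
  · exact .exists_tuple hN.1 (hN.isAttractor hs (Sum.inl n) Sum.inr)

end NumerationSystem

end StringAttractor

theorem theorem9 {D : Type*} [Finite D] (N : StringAttractor.NumerationSystem D)
    (hN : N.Regular) {A : Type*} (s : ℕ → A) (hs : N.Automatic s)
    (hO : ∃ c : ℕ, ∀ n : ℕ, ∃ S : Finset ℕ,
      StringAttractor.IsAttractor (StringAttractor.pref s n) S ∧ S.card ≤ c) :
    N.Synchronized (fun n => StringAttractor.maxSpan (StringAttractor.pref s n)) ∧
      N.Synchronized (fun n => StringAttractor.minSpan (StringAttractor.pref s n)) := by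
  obtain ⟨c, hc⟩ := hO
  constructor
  -- Being the greatest element of the set of spans is first-order, and that element is unique.
  · refine StringAttractor.NumerationSystem.RegularPred.recognizable hN.1 (.congr
      ((hN.mem_minAttractorSpans hs hc 0 1).and
        (.forall_nat hN.1 (P := fun (v : Fin 2 → ℕ) x =>
          x ∈ StringAttractor.minAttractorSpans (StringAttractor.pref s (v 0)) → x ≤ v 1)
          ((hN.mem_minAttractorSpans hs hc (some 0) none).imp (hN.le none (some 1))))) fun v => ?_)
    exact ⟨fun h => IsGreatest.unique h (StringAttractor.isGreatest_maxSpan _),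
      fun h => (show v 1 = _ from h) ▸ StringAttractor.isGreatest_maxSpan _⟩
  · refine StringAttractor.NumerationSystem.RegularPred.recognizable hN.1 (.congr
      ((hN.mem_minAttractorSpans hs hc 0 1).and
        (.forall_nat hN.1 (P := fun (v : Fin 2 → ℕ) x =>
          x ∈ StringAttractor.minAttractorSpans (StringAttractor.pref s (v 0)) → v 1 ≤ x)
          ((hN.mem_minAttractorSpans hs hc (some 0) none).imp (hN.le (some 1) none)))) fun v => ?_)
    exact ⟨fun h => IsLeast.unique h (StringAttractor.isLeast_minSpan _),
      fun h => (show v 1 = _ from h) ▸ StringAttractor.isLeast_minSpan _⟩
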